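/- Let $\mathcal L$ be the set of propositions (sentences) of propositional or predicate logic without equality, built from atoms with $\top,\bot,\neg,\wedge,\vee,\to,\leftrightarrow$ (and $\forall,\exists$ in predicate logic), and let $\vdash$ be derivability in classical logic (natural deduction). *Tableaux.* A supporting element is a proposition $\sigma$ (a premise) or a test $\psi?$ with $\psi\in\mathcal L$; premises and tests are distinct. An argument is a pair $(S,\psi)$ of a set $S$ of supporting elements and a proposition $\psi$. A node is a set of arguments. An argumentation tableau is a finite tree of nodes in which each non-leaf node $\Gamma$ has one or two children, obtained by adding to $\Gamma$ the conclusions (two children when they are separated by $\mid$) of one of the following rules applied to premises in $\Gamma$: $$\frac{(S,\varphi\wedge\psi)}{(S,\varphi),(S,\psi)}\quad \frac{(S,\varphi\vee\psi)}{(S,\varphi)\mid(S,\psi)}\quad \frac{(S,\varphi\to\psi)}{(S,\neg\varphi)\mid(S,\psi)}\quad \frac{(S,\varphi\leftrightarrow\psi)}{(S,\varphi\to\psi),(S,\psi\to\varphi)}$$ $$\frac{(S,\neg(\varphi\vee\psi))}{(S,\neg\varphi),(S,\neg\psi)}\quad \frac{(S,\neg(\varphi\wedge\psi))}{(S,\neg\varphi)\mid(S,\neg\psi)}\quad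 \frac{(S,\neg(\varphi\to\psi))}{(S,\varphi),(S,\neg\psi)}\quad \frac{(S,\neg(\varphi\leftrightarrow\psi))}{(S,\neg(\varphi\to\psi))\mid(S,\neg(\psi\to\varphi))}$$ $$\frac{(S,\neg\neg\varphi)}{(S,\varphi)}\quad \frac{(S,\neg\top)}{(S,\bot)}\quad \frac{(S,\varphi),(S',\neg\varphi)}{(S\cup S',\bot)}$$ and, in predicate logic, $$\frac{(S,\forall x\,\varphi)}{(S,\varphi[x/t])}\quad \frac{(S,\exists x\,\varphi)}{(S,\varphi[x/c])}\quad \frac{(S,\neg\forall x\,\varphi)}{(S,\neg\varphi[x/c])}\quad \frac{(S,\neg\exists x\,\varphi)}{(S,\neg\varphi[x/t])}$$ where $t$ is a ground term that occurs in $\Gamma$ (or, if no ground term occurs in $\Gamma$, any constant) and $c$ is a constant that does not occur in $\Gamma$. A tableau $\mathcal T'$ extends $\mathcal T$ if it results from $\mathcal T$ by applying (zero or more) further rules at the leaves. If $\Lambda_1,\dots,\Lambda_n$ are the leaves of $\mathcal T$ and $(S_i,\bot)\in\Lambda_i$ for every $i$, then $S_1\cup\dots\cup S_n$ is called a support for the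 closure of $\mathcal T$. *Statement.* Let $\Sigma\subseteq\mathcal L$, let $\varphi\in\mathcal L$, and let $\mathcal T$ be a tableau with root $\Gamma_0=\{(\{\sigma\},\sigma)\mid\sigma\in\Sigma\}\cup\{(\{\neg\varphi?\},\neg\varphi)\}$. 1. If $S$ is a support for the closure of $\mathcal T$ and $\neg\varphi?$ is the one and only test in $S$, then $S\setminus\{\neg\varphi?\}\vdash\varphi$. 2. In the case of predicate logic, suppose that infinitely many constants of the language do not occur in $\Sigma\cup\{\varphi\}$. Let $S'\subseteq\Sigma$ be a minimal set (with respect to inclusion) such that $S'\vdash\varphi$. If $S'$ is consistent, then there is a tableau $\mathcal T'$ that extends $\mathcal T$ such that $S'\cup\{\neg\varphi?\}$ is a support for the closure of $\mathcal T'$. If $S'$ is inconsistent, then there is a tableau $\mathcal T'$ that extends $\mathcal T$ such that $S'$ itself is a support for the closure of $\mathcal T'$. -/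

import Mathlib

universe u v w

namespace ArgTableau

/-- The two standard logics. -/
inductive Logic where
  | propositional
  | predicate

/-- The non-logical symbols: constants, function symbols of positive arity (`Func m` holds the
symbols of arity `m + 1`) and predicate symbols (`Pred m` holds the symbols of arity `m`; the
nullary ones are propositional letters). There is no equality symbol among the logical symbols. -/
structure Signature where
  Const : Type u
  Func : ℕ → Type v
  Pred : ℕ → Type w

/-- Terms over the bound variables `0, …, n - 1`. In particular `Term L 0` is the type of ground
terms. -/
inductive Term (L : Signature.{u, v, w}) (n : ℕ) : Type (max u v) where
  | const (c : L.Const) : Term L n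
  | bvar (i : Fin n) : Term L n
  | app {m : ℕ} (f : L.Func m) (ts : Fin (m + 1) → Term L n) : Term L n

namespace Term

variable {L : Signature.{u, v, w}}

/-- Simultaneous substitution of terms for the variables. -/
def subst {n m : ℕ} (s : Fin n → Term L m) : Term L n → Term L m
  | const c => const c
  | bvar i => s i
  | app f ts => app f (fun j => (ts j).subst s)

/-- A term over `n` variables, seen as a term over `n + 1` variables. -/
def weaken {n : ℕ} (t : Term L n) : Term L (n + 1) :=
  t.subst (fun i => bvar i.castSucc)

/-- A ground term, seen as a term over `n` variables. -/
def ofGround {n : ℕ} (t : Term L 0) : Term L n :=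
  t.subst (fun i => i.elim0)

/-- `t.HasSubterm s`: the term `s` is `t` or occurs inside `t`. -/
inductive HasSubterm {n : ℕ} : Term L n → Term L n → Prop where
  | refl (t : Term L n) : HasSubterm t t
  | arg {m : ℕ} (f : L.Func m) (ts : Fin (m + 1) → Term L n) (j : Fin (m + 1)) {s : Term L n}
      (h : HasSubterm (ts j) s) : HasSubterm (app f ts) s

end Term

/-- Formulas over the free variables `0, …, n - 1`. A quantifier in a formula over `n` variables
binds the variable with the last index `n` of its body. Quantifiers exist only in predicate logic:
their constructors ask for a proof of `k = .predicate`. -/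
inductive Formula (k : Logic) (L : Signature.{u, v, w}) : ℕ → Type (max u v w) where
  | atom {n m : ℕ} (P : L.Pred m) (ts : Fin m → Term L n) : Formula k L n
  | top {n : ℕ} : Formula k L n
  | bot {n : ℕ} : Formula k L n
  | neg {n : ℕ} (φ : Formula k L n) : Formula k L n
  | and {n : ℕ} (φ ψ : Formula k L n) : Formula k L n
  | or {n : ℕ} (φ ψ : Formula k L n) : Formula k L n
  | imp {n : ℕ} (φ ψ : Formula k L n) : Formula k L n
  | iff {n : ℕ} (φ ψ : Formula k L n) : Formula k L n
  | all {n : ℕ} (hk : k = .predicate) (φ : Formula k L (n + 1)) : Formula k L n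
  | ex {n : ℕ} (hk : k = .predicate) (φ : Formula k L (n + 1)) : Formula k L n

namespace Formula

variable {k : Logic} {L : Signature.{u, v, w}}

/-- Simultaneous substitution of terms for the free variables. -/
def subst : {n m : ℕ} → (Fin n → Term L m) → Formula k L n → Formula k L m
  | _, _, s, atom P ts => atom P (fun j => (ts j).subst s)
  | _, _, _, top => top
  | _, _, _, bot => bot
  | _, _, s, neg φ => neg (φ.subst s)
  | _, _, s, and φ ψ => and (φ.subst s) (ψ.subst s)
  | _, _, s, or φ ψ => or (φ.subst s) (ψ.subst s)
  | _, _, s, imp φ ψ => imp (φ.subst s) (ψ.subst s)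
  | _, _, s, iff φ ψ => iff (φ.subst s) (ψ.subst s)
  | _, m, s, all hk φ =>
      all hk (φ.subst (Fin.snoc (α := fun _ => Term L (m + 1))
        (fun i => (s i).weaken) (Term.bvar (Fin.last m))))
  | _, m, s, ex hk φ =>
      ex hk (φ.subst (Fin.snoc (α := fun _ => Term L (m + 1))
        (fun i => (s i).weaken) (Term.bvar (Fin.last m))))

/-- The instance of a formula in one free variable at a ground term. -/
def inst (φ : Formula k L 1) (t : Term L 0) : Formula k L 0 :=
  φ.subst (fun _ => t)

/-- The ground term `t` occurs in a formula. -/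
def Occurs (t : Term L 0) : {n : ℕ} → Formula k L n → Prop
  | _, atom _ ts => ∃ j, (ts j).HasSubterm t.ofGround
  | _, top => False
  | _, bot => False
  | _, neg φ => φ.Occurs t
  | _, and φ ψ => φ.Occurs t ∨ ψ.Occurs t
  | _, or φ ψ => φ.Occurs t ∨ ψ.Occurs t
  | _, imp φ ψ => φ.Occurs t ∨ ψ.Occurs t
  | _, iff φ ψ => φ.Occurs t ∨ ψ.Occurs t
  | _, all _ φ => φ.Occurs t
  | _, ex _ φ => φ.Occurs t

end Formula

/-- The propositions: the formulas without free variables. -/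
abbrev Proposition (k : Logic) (L : Signature.{u, v, w}) : Type (max u v w) := Formula k L 0

/-- Derivability in classical logic, as Gentzen-style natural deduction. In the rules `all_intro`
and `ex_elim` the constant `c` is the eigenconstant. -/
inductive Derives {k : Logic} {L : Signature.{u, v, w}} :
    Set (Proposition k L) → Proposition k L → Prop where
  | hyp {Γ : Set (Proposition k L)} {φ : Proposition k L} (h : φ ∈ Γ) : Derives Γ φ
  | weaken {Γ Δ : Set (Proposition k L)} {φ : Proposition k L} (hs : Γ ⊆ Δ)
      (h : Derives Γ φ) : Derives Δ φ
  | top_intro {Γ : Set (Proposition k L)} : Derives Γ .top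
  | bot_elim {Γ : Set (Proposition k L)} {φ : Proposition k L}
      (h : Derives Γ .bot) : Derives Γ φ
  | by_contradiction {Γ : Set (Proposition k L)} {φ : Proposition k L}
      (h : Derives (insert φ.neg Γ) .bot) : Derives Γ φ
  | neg_intro {Γ : Set (Proposition k L)} {φ : Proposition k L}
      (h : Derives (insert φ Γ) .bot) : Derives Γ φ.neg
  | neg_elim {Γ : Set (Proposition k L)} {φ : Proposition k L}
      (h₁ : Derives Γ φ) (h₂ : Derives Γ φ.neg) : Derives Γ .bot
  | and_intro {Γ : Set (Proposition k L)} {φ ψ : Proposition k L}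
      (h₁ : Derives Γ φ) (h₂ : Derives Γ ψ) : Derives Γ (φ.and ψ)
  | and_left {Γ : Set (Proposition k L)} {φ ψ : Proposition k L}
      (h : Derives Γ (φ.and ψ)) : Derives Γ φ
  | and_right {Γ : Set (Proposition k L)} {φ ψ : Proposition k L}
      (h : Derives Γ (φ.and ψ)) : Derives Γ ψ
  | or_inl {Γ : Set (Proposition k L)} {φ ψ : Proposition k L}
      (h : Derives Γ φ) : Derives Γ (φ.or ψ)
  | or_inr {Γ : Set (Proposition k L)} {φ ψ : Proposition k L}
      (h : Derives Γ ψ) : Derives Γ (φ.or ψ)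
  | or_elim {Γ : Set (Proposition k L)} {φ ψ χ : Proposition k L}
      (h : Derives Γ (φ.or ψ)) (h₁ : Derives (insert φ Γ) χ)
      (h₂ : Derives (insert ψ Γ) χ) : Derives Γ χ
  | imp_intro {Γ : Set (Proposition k L)} {φ ψ : Proposition k L}
      (h : Derives (insert φ Γ) ψ) : Derives Γ (φ.imp ψ)
  | imp_elim {Γ : Set (Proposition k L)} {φ ψ : Proposition k L}
      (h₁ : Derives Γ (φ.imp ψ)) (h₂ : Derives Γ φ) : Derives Γ ψ
  | iff_intro {Γ : Set (Proposition k L)} {φ ψ : Proposition k L}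
      (h₁ : Derives Γ (φ.imp ψ)) (h₂ : Derives Γ (ψ.imp φ)) : Derives Γ (φ.iff ψ)
  | iff_left {Γ : Set (Proposition k L)} {φ ψ : Proposition k L}
      (h : Derives Γ (φ.iff ψ)) : Derives Γ (φ.imp ψ)
  | iff_right {Γ : Set (Proposition k L)} {φ ψ : Proposition k L}
      (h : Derives Γ (φ.iff ψ)) : Derives Γ (ψ.imp φ)
  | all_intro {Γ : Set (Proposition k L)} {hk : k = .predicate} {φ : Formula k L 1}
      (c : L.Const) (hcΓ : ∀ γ ∈ Γ, ¬ γ.Occurs (.const c)) (hcφ : ¬ φ.Occurs (.const c))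
      (h : Derives Γ (φ.inst (.const c))) : Derives Γ (.all hk φ)
  | all_elim {Γ : Set (Proposition k L)} {hk : k = .predicate} {φ : Formula k L 1}
      (t : Term L 0) (h : Derives Γ (.all hk φ)) : Derives Γ (φ.inst t)
  | ex_intro {Γ : Set (Proposition k L)} {hk : k = .predicate} {φ : Formula k L 1}
      (t : Term L 0) (h : Derives Γ (φ.inst t)) : Derives Γ (.ex hk φ)
  | ex_elim {Γ : Set (Proposition k L)} {hk : k = .predicate} {φ : Formula k L 1}
      {χ : Proposition k L}
      (c : L.Const) (hcΓ : ∀ γ ∈ Γ, ¬ γ.Occurs (.const c)) (hcφ : ¬ φ.Occurs (.const c))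
      (hcχ : ¬ χ.Occurs (.const c)) (h : Derives Γ (.ex hk φ))
      (h' : Derives (insert (φ.inst (.const c)) Γ) χ) : Derives Γ χ

/-- The supporting elements: a premise `σ`, or a test `ψ?`. -/
inductive Element (k : Logic) (L : Signature.{u, v, w}) : Type (max u v w) where
  | premise (σ : Proposition k L) : Element k L
  | test (ψ : Proposition k L) : Element k L

namespace Element

variable {k : Logic} {L : Signature.{u, v, w}}

/-- The proposition of a supporting element, with the question mark of a test dropped. -/
def prop : Element k L → Proposition k L
  | premise σ => σ
  | test ψ => ψ

def IsTest : Element k L → Prop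
  | premise _ => False
  | test _ => True

end Element

/-- An argument `(S, φ)`, with support `S` and conclusion `φ`. -/
abbrev Argument (k : Logic) (L : Signature.{u, v, w}) : Type (max u v w) :=
  Set (Element k L) × Proposition k L

/-- A node of a tableau is a set of arguments. -/
abbrev Node (k : Logic) (L : Signature.{u, v, w}) : Type (max u v w) := Set (Argument k L)

/-- The ground term `t` occurs in the node `Γ`. -/
def Node.Occurs {k : Logic} {L : Signature.{u, v, w}} (t : Term L 0) (Γ : Node k L) : Prop :=
  ∃ A ∈ Γ, A.2.Occurs t

/-- The ground terms at which a universal proposition may be instantiated in the node `Γ`: those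
that occur in `Γ` or, if no ground term occurs in `Γ`, any constant. -/
def Node.Available {k : Logic} {L : Signature.{u, v, w}} (Γ : Node k L) (t : Term L 0) : Prop :=
  Node.Occurs t Γ ∨ ((∀ s : Term L 0, ¬ Node.Occurs s Γ) ∧ ∃ c : L.Const, t = .const c)

/-- The tableau rules without branching: `Step Γ Δ` says that a rule applies to premises in `Γ` and
that `Δ` is the set of its conclusions. -/
inductive Step {k : Logic} {L : Signature.{u, v, w}} (Γ : Node k L) : Node k L → Prop where
  | and {S : Set (Element k L)} {φ ψ : Proposition k L}
      (h : (S, φ.and ψ) ∈ Γ) : Step Γ {(S, φ), (S, ψ)}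
  | iff {S : Set (Element k L)} {φ ψ : Proposition k L}
      (h : (S, φ.iff ψ) ∈ Γ) : Step Γ {(S, φ.imp ψ), (S, ψ.imp φ)}
  | neg_or {S : Set (Element k L)} {φ ψ : Proposition k L}
      (h : (S, (φ.or ψ).neg) ∈ Γ) : Step Γ {(S, φ.neg), (S, ψ.neg)}
  | neg_imp {S : Set (Element k L)} {φ ψ : Proposition k L}
      (h : (S, (φ.imp ψ).neg) ∈ Γ) : Step Γ {(S, φ), (S, ψ.neg)}
  | neg_neg {S : Set (Element k L)} {φ : Proposition k L}
      (h : (S, φ.neg.neg) ∈ Γ) : Step Γ {(S, φ)}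
  | neg_top {S : Set (Element k L)}
      (h : (S, Formula.neg .top) ∈ Γ) : Step Γ {(S, .bot)}
  | close {S S' : Set (Element k L)} {φ : Proposition k L}
      (h : (S, φ) ∈ Γ) (h' : (S', φ.neg) ∈ Γ) : Step Γ {(S ∪ S', .bot)}
  | all {S : Set (Element k L)} {hk : k = .predicate} {φ : Formula k L 1} (t : Term L 0)
      (h : (S, .all hk φ) ∈ Γ) (ht : Node.Available Γ t) : Step Γ {(S, φ.inst t)}
  | ex {S : Set (Element k L)} {hk : k = .predicate} {φ : Formula k L 1} (c : L.Const)
      (h : (S, .ex hk φ) ∈ Γ) (hc : ¬ Node.Occurs (.const c) Γ) :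
      Step Γ {(S, φ.inst (.const c))}
  | neg_all {S : Set (Element k L)} {hk : k = .predicate} {φ : Formula k L 1} (c : L.Const)
      (h : (S, (Formula.all hk φ).neg) ∈ Γ) (hc : ¬ Node.Occurs (.const c) Γ) :
      Step Γ {(S, (φ.inst (.const c)).neg)}
  | neg_ex {S : Set (Element k L)} {hk : k = .predicate} {φ : Formula k L 1} (t : Term L 0)
      (h : (S, (Formula.ex hk φ).neg) ∈ Γ) (ht : Node.Available Γ t) :
      Step Γ {(S, (φ.inst t).neg)}

/-- The branching tableau rules: `Split Γ Δ₁ Δ₂` says that a rule applies to a premise in `Γ` and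
that `Δ₁ | Δ₂` are its alternative conclusions. -/
inductive Split {k : Logic} {L : Signature.{u, v, w}} (Γ : Node k L) :
    Node k L → Node k L → Prop where
  | or {S : Set (Element k L)} {φ ψ : Proposition k L}
      (h : (S, φ.or ψ) ∈ Γ) : Split Γ {(S, φ)} {(S, ψ)}
  | imp {S : Set (Element k L)} {φ ψ : Proposition k L}
      (h : (S, φ.imp ψ) ∈ Γ) : Split Γ {(S, φ.neg)} {(S, ψ)}
  | neg_and {S : Set (Element k L)} {φ ψ : Proposition k L}
      (h : (S, (φ.and ψ).neg) ∈ Γ) : Split Γ {(S, φ.neg)} {(S, ψ.neg)}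
  | neg_iff {S : Set (Element k L)} {φ ψ : Proposition k L}
      (h : (S, (φ.iff ψ).neg) ∈ Γ) : Split Γ {(S, (φ.imp ψ).neg)} {(S, (ψ.imp φ).neg)}

/-- The (finite) argumentation tableaux with root `Γ`. A child of a node consists of the arguments
of that node together with the new ones. -/
inductive Tableau {k : Logic} {L : Signature.{u, v, w}} : Node k L → Type (max u v w) where
  | leaf (Γ : Node k L) : Tableau Γ
  | step {Γ Δ : Node k L} (h : Step Γ Δ) (T : Tableau (Γ ∪ Δ)) : Tableau Γ
  | split {Γ Δ₁ Δ₂ : Node k L} (h : Split Γ Δ₁ Δ₂)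
      (T₁ : Tableau (Γ ∪ Δ₁)) (T₂ : Tableau (Γ ∪ Δ₂)) : Tableau Γ

namespace Tableau

variable {k : Logic} {L : Signature.{u, v, w}}

/-- The leaf nodes, from left to right. -/
def leaves : {Γ : Node k L} → Tableau Γ → List (Node k L)
  | _, leaf Γ => [Γ]
  | _, step _ T => T.leaves
  | _, split _ T₁ T₂ => T₁.leaves ++ T₂.leaves

/-- `T.Extends T'`: the tableau `T'` extends `T`, that is, `T'` results from `T` when further
tableau rules are applied at the leaves of `T`. -/
inductive Extends : {Γ : Node k L} → Tableau Γ → Tableau Γ → Prop where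
  | leaf {Γ : Node k L} (T' : Tableau Γ) : Extends (leaf Γ) T'
  | step {Γ Δ : Node k L} (h : Step Γ Δ) {T T' : Tableau (Γ ∪ Δ)} (e : Extends T T') :
      Extends (step h T) (step h T')
  | split {Γ Δ₁ Δ₂ : Node k L} (h : Split Γ Δ₁ Δ₂) {T₁ T₁' : Tableau (Γ ∪ Δ₁)}
      {T₂ T₂' : Tableau (Γ ∪ Δ₂)} (e₁ : Extends T₁ T₁') (e₂ : Extends T₂ T₂') :
      Extends (split h T₁ T₂) (split h T₁' T₂')

/-- `S` is a support for the closure of `T`: with `Λ₁, …, Λₙ` the leaves of `T`, there are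
`(S₁, ⊥) ∈ Λ₁, …, (Sₙ, ⊥) ∈ Λₙ` such that `S = S₁ ∪ ⋯ ∪ Sₙ`. -/
def IsClosureSupport {Γ : Node k L} (T : Tableau Γ) (S : Set (Element k L)) : Prop :=
  ∃ Ss : List (Set (Element k L)),
    List.Forall₂ (fun Sᵢ Λᵢ => (Sᵢ, Formula.bot) ∈ Λᵢ) Ss T.leaves ∧ S = ⋃ Sᵢ ∈ Ss, Sᵢ

end Tableau

/-- The root `{({σ}, σ) | σ ∈ Σ} ∪ {({¬φ?}, ¬φ)}`. -/
def testRoot {k : Logic} {L : Signature.{u, v, w}} (Sig : Set (Proposition k L))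
    (φ : Proposition k L) : Node k L :=
  (fun σ => ({Element.premise σ}, σ)) '' Sig ∪ {({Element.test φ.neg}, φ.neg)}

end ArgTableau

/-!
Both parts concern, for a node `Γ` and a set `E` of supporting elements, the set `conclusions E Γ`
of the conclusions of those arguments in `Γ` whose support is contained in `E`.

Soundness. If `S` is a support for the closure of a tableau with root `Γ`, then `conclusions S Γ` is
inconsistent (`Tableau.IsClosureSupport.derives_bot`, by induction on the tableau). A rule applied
to an argument with support outside `S` changes nothing, and the constant introduced by a rule for
`∃` or `¬∀` is new in the whole node, so that it is an eigenconstant. At the root this says that the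
propositions of the elements of `S` are inconsistent, hence that the premises in `S` derive the
tested proposition.

Completeness. If `conclusions E Γ` is finite and inconsistent and infinitely many constants are new,
then some tableau with root `Γ` has a support for its closure inside `E` (`Saturable.closable`).
Otherwise `Γ` is an open node, and open nodes can be enlarged in rounds: a round expands each of the
finitely many conclusions at hand and instantiates at every ground term at hand. The union of the
rounds is a Hintikka set (`IsOpenNode.exists_isHintikka`), true in a Herbrand model whose domain has
only the ground terms that occur in it and at most one further constant, because other terms are not
available to the rules (`IsHintikka.herbrand_sat`); this contradicts the soundness of derivations
(`Derives.sound`). The further constant makes the domain nonempty if the language has constants, and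
it has to stay available. Either some open extension of `Γ` contains a constant, which then serves,
or none contains a ground term, and then any constant is available in all of them
(`IsOpenNode.exists_available`).

Let `S'` be a minimal set of premises that derives `φ`. It is finite by compactness. Completeness,
applied at every leaf of the given tableau, yields an extension whose closure has a support `S`
inside `E`, where `E` consists of `S'` and, when `S'` is consistent, the test of `¬φ`. By soundness
the premises in `S` derive `φ`, so all of `S'` is in `S` by minimality; and if `S'` is consistent,
then the test is in `S` as well.
-/

namespace ArgTableau

/-! ### Derivability -/

namespace Derives

variable {k : Logic} {L : Signature.{u, v, w}}

theorem cut {Γ : Set (Proposition k L)} {φ ψ : Proposition k L}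
    (h₁ : Derives Γ φ) (h₂ : Derives (insert φ Γ) ψ) : Derives Γ ψ :=
  (imp_intro h₂).imp_elim h₁

theorem cut_finite {Γ Δ : Set (Proposition k L)} {ψ : Proposition k L} (hΔ : Δ.Finite)
    (h₁ : ∀ φ ∈ Δ, Derives Γ φ) (h₂ : Derives (Γ ∪ Δ) ψ) : Derives Γ ψ := by
  induction Δ, hΔ using Set.Finite.induction_on with
  | empty => simpa using h₂
  | @insert a s _ _ ih =>
    refine ih (fun φ hφ => h₁ φ (Set.mem_insert_of_mem _ hφ)) ?_
    refine cut (weaken Set.subset_union_left (h₁ a (Set.mem_insert _ _))) ?_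
    rwa [← Set.union_insert]

/-- Derivations are finite, so only finitely many hypotheses are used. -/
theorem exists_finite {Γ : Set (Proposition k L)} {φ : Proposition k L} (h : Derives Γ φ) :
    ∃ Δ ⊆ Γ, Δ.Finite ∧ Derives Δ φ := by
  have key : ∀ {Γ Δ : Set (Proposition k L)} {φ χ : Proposition k L}, Δ ⊆ insert φ Γ →
      Δ.Finite → Derives Δ χ → ∃ Δ' ⊆ Γ, Δ'.Finite ∧ Derives (insert φ Δ') χ := by
    intro Γ Δ φ χ hs hf hd
    refine ⟨Δ \ {φ}, by rintro x ⟨hx, hne⟩; exact (hs hx).resolve_left hne, hf.sdiff, ?_⟩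
    refine weaken ?_ hd
    intro x hx
    by_cases hxφ : x = φ
    · exact Or.inl hxφ
    · exact Or.inr ⟨hx, hxφ⟩
  have two : ∀ {Γ : Set (Proposition k L)} {φ ψ χ : Proposition k L},
      (∃ Δ ⊆ Γ, Δ.Finite ∧ Derives Δ φ) → (∃ Δ ⊆ Γ, Δ.Finite ∧ Derives Δ ψ) →
      (∀ Δ, Derives Δ φ → Derives Δ ψ → Derives Δ χ) →
      ∃ Δ ⊆ Γ, Δ.Finite ∧ Derives Δ χ := by
    rintro Γ φ ψ χ ⟨Δ₁, hs₁, hf₁, hd₁⟩ ⟨Δ₂, hs₂, hf₂, hd₂⟩ H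
    exact ⟨Δ₁ ∪ Δ₂, Set.union_subset hs₁ hs₂, hf₁.union hf₂,
      H _ (weaken Set.subset_union_left hd₁) (weaken Set.subset_union_right hd₂)⟩
  induction h with
  | @hyp Γ φ h => exact ⟨{φ}, by simpa using h, Set.finite_singleton _, hyp rfl⟩
  | weaken hs _ ih =>
    obtain ⟨Δ, hΔ, hf, hd⟩ := ih
    exact ⟨Δ, hΔ.trans hs, hf, hd⟩
  | top_intro => exact ⟨∅, Set.empty_subset _, Set.finite_empty, top_intro⟩
  | bot_elim _ ih => exact two ih ih fun _ h _ => bot_elim h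
  | by_contradiction _ ih =>
    obtain ⟨Δ, hΔ, hf, hd⟩ := ih
    obtain ⟨Δ', hs, hf', hd'⟩ := key hΔ hf hd
    exact ⟨Δ', hs, hf', by_contradiction hd'⟩
  | neg_intro _ ih =>
    obtain ⟨Δ, hΔ, hf, hd⟩ := ih
    obtain ⟨Δ', hs, hf', hd'⟩ := key hΔ hf hd
    exact ⟨Δ', hs, hf', neg_intro hd'⟩
  | neg_elim _ _ ih₁ ih₂ => exact two ih₁ ih₂ fun _ => neg_elim
  | and_intro _ _ ih₁ ih₂ => exact two ih₁ ih₂ fun _ => and_intro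
  | and_left _ ih => exact two ih ih fun _ h _ => and_left h
  | and_right _ ih => exact two ih ih fun _ h _ => and_right h
  | or_inl _ ih => exact two ih ih fun _ h _ => or_inl h
  | or_inr _ ih => exact two ih ih fun _ h _ => or_inr h
  | or_elim _ _ _ ih ih₁ ih₂ =>
    obtain ⟨Δ₁, hΔ₁, hf₁, hd₁⟩ := ih₁
    obtain ⟨Δ₁', hs₁, hf₁', hd₁'⟩ := key hΔ₁ hf₁ hd₁
    obtain ⟨Δ₂, hΔ₂, hf₂, hd₂⟩ := ih₂
    obtain ⟨Δ₂', hs₂, hf₂', hd₂'⟩ := key hΔ₂ hf₂ hd₂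
    exact two (two ih ⟨Δ₁', hs₁, hf₁', imp_intro hd₁'⟩ fun _ => and_intro)
      ⟨Δ₂', hs₂, hf₂', imp_intro hd₂'⟩ fun Δ h h' => or_elim h.and_left
        (imp_elim (weaken (Set.subset_insert _ _) h.and_right) (hyp (Set.mem_insert _ _)))
        (imp_elim (weaken (Set.subset_insert _ _) h') (hyp (Set.mem_insert _ _)))
  | imp_intro _ ih =>
    obtain ⟨Δ, hΔ, hf, hd⟩ := ih
    obtain ⟨Δ', hs, hf', hd'⟩ := key hΔ hf hd
    exact ⟨Δ', hs, hf', imp_intro hd'⟩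
  | imp_elim _ _ ih₁ ih₂ => exact two ih₁ ih₂ fun _ => imp_elim
  | iff_intro _ _ ih₁ ih₂ => exact two ih₁ ih₂ fun _ => iff_intro
  | iff_left _ ih => exact two ih ih fun _ h _ => iff_left h
  | iff_right _ ih => exact two ih ih fun _ h _ => iff_right h
  | all_intro c hcΓ hcφ _ ih =>
    obtain ⟨Δ, hΔ, hf, hd⟩ := ih
    exact ⟨Δ, hΔ, hf, all_intro c (fun γ hγ => hcΓ γ (hΔ hγ)) hcφ hd⟩
  | all_elim t _ ih => exact two ih ih fun _ h _ => all_elim t h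
  | ex_intro t _ ih => exact two ih ih fun _ h _ => ex_intro t h
  | ex_elim c hcΓ hcφ hcχ _ _ ih ih' =>
    obtain ⟨Δ₁, hs₁, hf₁, hd₁⟩ := ih
    obtain ⟨Δ, hΔ, hf, hd⟩ := ih'
    obtain ⟨Δ₂, hs₂, hf₂, hd₂⟩ := key hΔ hf hd
    have hs := Set.union_subset hs₁ hs₂
    exact ⟨Δ₁ ∪ Δ₂, hs, hf₁.union hf₂,
      ex_elim c (fun γ hγ => hcΓ γ (hs hγ)) hcφ hcχ (weaken Set.subset_union_left hd₁)
        (weaken (Set.insert_subset_insert Set.subset_union_right) hd₂)⟩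

end Derives

/-! ### Ground terms occurring in terms and formulas -/

namespace Term

variable {L : Signature.{u, v, w}}

theorem subst_subst {n m l : ℕ} (s : Fin n → Term L m) (s' : Fin m → Term L l) (t : Term L n) :
    (t.subst s).subst s' = t.subst (fun i => (s i).subst s') := by
  induction t with
  | const c => rfl
  | bvar i => rfl
  | app f ts ih => simp only [subst, ih]

theorem subst_ground (s : Fin 0 → Term L 0) (t : Term L 0) : t.subst s = t := by
  induction t with
  | const c => rfl
  | bvar i => exact i.elim0
  | app f ts ih => simp only [subst, ih]

theorem ofGround_ground (t : Term L 0) : (t.ofGround : Term L 0) = t :=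
  subst_ground _ t

theorem ofGround_subst {n : ℕ} (s : Fin n → Term L 0) (t : Term L 0) :
    (t.ofGround : Term L n).subst s = t := by
  rw [ofGround, subst_subst, subst_ground]

theorem ofGround_injective (n : ℕ) :
    Function.Injective (ofGround : Term L 0 → Term L n) := by
  intro t t' h
  rw [← ofGround_subst (n := n) (fun _ => t) t, h, ofGround_subst]

theorem HasSubterm.trans {n : ℕ} {r s t : Term L n} (h₁ : r.HasSubterm s)
    (h₂ : s.HasSubterm t) : r.HasSubterm t := by
  induction h₁ with
  | refl => exact h₂
  | arg f ts j _ ih => exact .arg f ts j (ih h₂)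

theorem HasSubterm.subst {n m : ℕ} {s t : Term L n} (h : s.HasSubterm t)
    (σ : Fin n → Term L m) : (s.subst σ).HasSubterm (t.subst σ) := by
  induction h with
  | refl => exact .refl _
  | arg f ts j _ ih => exact .arg f _ j ih

theorem finite_subterms {n : ℕ} (t : Term L n) : {s | t.HasSubterm s}.Finite := by
  induction t with
  | const c =>
    refine (Set.finite_singleton (const c)).subset ?_
    rintro s ⟨⟩
    rfl
  | bvar i =>
    refine (Set.finite_singleton (bvar i)).subset ?_
    rintro s ⟨⟩
    rfl
  | app f ts ih =>
    refine ((Set.finite_iUnion ih).insert (app f ts)).subset ?_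
    rintro s (_ | ⟨_, _, j, h⟩)
    · exact Set.mem_insert _ _
    · exact Or.inr (Set.mem_iUnion.2 ⟨j, h⟩)

theorem exists_const_hasSubterm (t : Term L 0) : ∃ c, t.HasSubterm (const c) := by
  induction t with
  | const c => exact ⟨c, .refl _⟩
  | bvar i => exact i.elim0
  | app f ts ih =>
    obtain ⟨c, hc⟩ := ih 0
    exact ⟨c, .arg f ts 0 hc⟩

end Term

namespace Formula

variable {k : Logic} {L : Signature.{u, v, w}}

theorem Occurs.of_hasSubterm {n : ℕ} {φ : Formula k L n} {t s : Term L 0} (h : φ.Occurs t)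
    (hs : t.HasSubterm s) : φ.Occurs s := by
  induction φ with
  | atom P ts =>
    obtain ⟨j, hj⟩ := h
    exact ⟨j, hj.trans (hs.subst _)⟩
  | top | bot => exact h
  | neg φ ih | all _ φ ih | ex _ φ ih => exact ih h
  | and φ ψ ih₁ ih₂ | or φ ψ ih₁ ih₂ | imp φ ψ ih₁ ih₂ | iff φ ψ ih₁ ih₂ =>
    exact h.imp ih₁ ih₂

theorem finite_occurs {n : ℕ} (φ : Formula k L n) : {t | φ.Occurs t}.Finite := by
  induction φ with
  | atom P ts =>
    have := Set.finite_iUnion fun j =>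
      (ts j).finite_subterms.preimage (Term.ofGround_injective _).injOn
    refine this.subset ?_
    rintro t ⟨j, hj⟩
    exact Set.mem_iUnion.2 ⟨j, hj⟩
  | top | bot => exact Set.finite_empty
  | neg φ ih | all _ φ ih | ex _ φ ih => exact ih
  | and φ ψ ih₁ ih₂ | or φ ψ ih₁ ih₂ | imp φ ψ ih₁ ih₂ | iff φ ψ ih₁ ih₂ =>
    exact ih₁.union ih₂

end Formula

/-! ### Tarskian semantics -/

/-- An interpretation of the non-logical symbols in the domain `M`, which may be empty if there
are no constants. -/
structure Interp (L : Signature.{u, v, w}) (M : Type*) where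
  const : L.Const → M
  func {m : ℕ} : L.Func m → (Fin (m + 1) → M) → M
  pred {m : ℕ} : L.Pred m → (Fin m → M) → Prop

variable {k : Logic} {L : Signature.{u, v, w}} {M : Type*}

/-- The value of a term under an assignment of the variables. -/
def Term.eval (I : Interp L M) {n : ℕ} (a : Fin n → M) : Term L n → M
  | const c => I.const c
  | bvar i => a i
  | app f ts => I.func f (fun j => (ts j).eval I a)

/-- Truth of a formula under an assignment of the variables. -/
def Formula.Holds (I : Interp L M) : {n : ℕ} → (Fin n → M) → Formula k L n → Prop
  | _, a, atom P ts => I.pred P (fun j => (ts j).eval I a)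
  | _, _, top => True
  | _, _, bot => False
  | _, a, neg φ => ¬ φ.Holds I a
  | _, a, and φ ψ => φ.Holds I a ∧ ψ.Holds I a
  | _, a, or φ ψ => φ.Holds I a ∨ ψ.Holds I a
  | _, a, imp φ ψ => φ.Holds I a → ψ.Holds I a
  | _, a, iff φ ψ => φ.Holds I a ↔ ψ.Holds I a
  | n, a, all _ φ => ∀ d : M, φ.Holds I (Fin.snoc (α := fun _ : Fin (n + 1) => M) a d)
  | n, a, ex _ φ => ∃ d : M, φ.Holds I (Fin.snoc (α := fun _ : Fin (n + 1) => M) a d)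

/-- Truth of a proposition. -/
def Interp.Sat (I : Interp L M) (φ : Proposition k L) : Prop :=
  φ.Holds I Fin.elim0

/-- The interpretation `I` with the value of the constant `c` changed to `d`. -/
noncomputable def Interp.update (I : Interp L M) (c : L.Const) (d : M) : Interp L M :=
  open Classical in { I with const := Function.update I.const c d }

theorem Term.eval_subst (I : Interp L M) {n m : ℕ} (s : Fin n → Term L m) (a : Fin m → M)
    (t : Term L n) : (t.subst s).eval I a = t.eval I (fun i => (s i).eval I a) := by
  induction t with
  | const c => rfl
  | bvar i => rfl
  | app f ts ih => simp only [subst, eval, ih]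

theorem Formula.holds_subst (I : Interp L M) {n m : ℕ} (s : Fin n → Term L m) (a : Fin m → M)
    (φ : Formula k L n) : (φ.subst s).Holds I a ↔ φ.Holds I (fun i => (s i).eval I a) := by
  have snoc_eq : ∀ {n m : ℕ} (s : Fin n → Term L m) (a : Fin m → M) (d : M),
      (fun i => Term.eval I (Fin.snoc (α := fun _ : Fin (m + 1) => M) a d)
        (Fin.snoc (α := fun _ => Term L (m + 1)) (fun i => (s i).weaken)
          (Term.bvar (Fin.last m)) i)) =
      Fin.snoc (α := fun _ : Fin (n + 1) => M) (fun i => (s i).eval I a) d := by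
    intro n m s a d
    funext i
    refine Fin.lastCases ?_ (fun i => ?_) i
    · simp [Term.eval]
    · simp [Term.weaken, Term.eval_subst, Term.eval]
  induction φ generalizing m with
  | atom P ts => simp only [subst, Holds, Term.eval_subst]
  | top | bot => rfl
  | neg φ ih => simp only [subst, Holds, ih]
  | and φ ψ ih₁ ih₂ | or φ ψ ih₁ ih₂ | imp φ ψ ih₁ ih₂ | iff φ ψ ih₁ ih₂ =>
    simp only [subst, Holds, ih₁, ih₂]
  | all _ φ ih | ex _ φ ih => simp only [subst, Holds, ih, snoc_eq]

theorem Interp.sat_inst (I : Interp L M) (φ : Formula k L 1) (t : Term L 0) :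
    I.Sat (φ.inst t) ↔ φ.Holds I (fun _ => t.eval I Fin.elim0) :=
  Formula.holds_subst I _ _ φ

theorem snoc_elim0 (d : M) :
    Fin.snoc (α := fun _ : Fin (0 + 1) => M) Fin.elim0 d = fun _ => d := by
  funext i
  rw [show i = Fin.last 0 from Subsingleton.elim (α := Fin 1) _ _, Fin.snoc_last]

theorem Interp.sat_all (I : Interp L M) (hk : k = .predicate) (φ : Formula k L 1) :
    I.Sat (.all hk φ) ↔ ∀ d, φ.Holds I (fun _ => d) := by
  simp only [Sat, Formula.Holds, snoc_elim0]

theorem Interp.sat_ex (I : Interp L M) (hk : k = .predicate) (φ : Formula k L 1) :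
    I.Sat (.ex hk φ) ↔ ∃ d, φ.Holds I (fun _ => d) := by
  simp only [Sat, Formula.Holds, snoc_elim0]

theorem Term.eval_update (I : Interp L M) (c : L.Const) (d : M) {n : ℕ} (a : Fin n → M)
    (t : Term L n) (hc : ¬ t.HasSubterm (.const c)) :
    t.eval (I.update c d) a = t.eval I a := by
  induction t with
  | const c' =>
    have : c' ≠ c := by rintro rfl; exact hc (.refl _)
    simp only [eval, Interp.update]
    classical exact Function.update_of_ne this _ _
  | bvar i => rfl
  | app f ts ih =>
    simp only [eval]
    rw [funext fun j => ih j fun h => hc (.arg f ts j h)]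
    rfl

theorem Formula.holds_update (I : Interp L M) (c : L.Const) (d : M) {n : ℕ} (a : Fin n → M)
    (φ : Formula k L n) (hc : ¬ φ.Occurs (.const c)) :
    φ.Holds (I.update c d) a ↔ φ.Holds I a := by
  induction φ with
  | atom P ts =>
    simp only [Holds]
    rw [funext fun j => Term.eval_update I c d a (ts j) fun h => hc ⟨j, h⟩]
    rfl
  | top | bot => rfl
  | neg φ ih => simp only [Holds, ih _ hc]
  | and φ ψ ih₁ ih₂ | or φ ψ ih₁ ih₂ | imp φ ψ ih₁ ih₂ | iff φ ψ ih₁ ih₂ =>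
    simp only [Holds, ih₁ _ fun h => hc (Or.inl h), ih₂ _ fun h => hc (Or.inr h)]
  | all _ φ ih | ex _ φ ih => simp only [Holds, ih _ hc]

theorem Interp.sat_update_inst (I : Interp L M) (c : L.Const) (d : M) (φ : Formula k L 1)
    (hc : ¬ φ.Occurs (.const c)) :
    (I.update c d).Sat (φ.inst (.const c)) ↔ φ.Holds I (fun _ => d) := by
  rw [sat_inst, Formula.holds_update I c d _ φ hc]
  simp [Term.eval, update]

/-- The eigenconstant rules are handled by changing the value of the eigenconstant. -/
theorem Derives.sound {Γ : Set (Proposition k L)} {φ : Proposition k L} (h : Derives Γ φ)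
    (I : Interp L M) (hI : ∀ γ ∈ Γ, I.Sat γ) : I.Sat φ := by
  have hins : ∀ {Γ : Set (Proposition k L)} {φ : Proposition k L} {I : Interp L M},
      (∀ γ ∈ Γ, I.Sat γ) → I.Sat φ → ∀ γ ∈ insert φ Γ, I.Sat γ := by
    rintro Γ φ I h₁ h₂ γ (rfl | hγ)
    · exact h₂
    · exact h₁ γ hγ
  induction h generalizing I with
  | hyp h => exact hI _ h
  | weaken hs _ ih => exact ih I fun γ hγ => hI γ (hs hγ)
  | top_intro => trivial
  | bot_elim _ ih => exact (ih I hI).elim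
  | by_contradiction _ ih =>
    by_contra hn
    exact ih I (hins hI hn)
  | neg_intro _ ih => exact fun hφ => ih I (hins hI hφ)
  | neg_elim _ _ ih₁ ih₂ => exact ih₂ I hI (ih₁ I hI)
  | and_intro _ _ ih₁ ih₂ => exact ⟨ih₁ I hI, ih₂ I hI⟩
  | and_left _ ih => exact (ih I hI).1
  | and_right _ ih => exact (ih I hI).2
  | or_inl _ ih => exact Or.inl (ih I hI)
  | or_inr _ ih => exact Or.inr (ih I hI)
  | or_elim _ _ _ ih ih₁ ih₂ =>
    exact (ih I hI).elim (fun h => ih₁ I (hins hI h)) (fun h => ih₂ I (hins hI h))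
  | imp_intro _ ih => exact fun h => ih I (hins hI h)
  | imp_elim _ _ ih₁ ih₂ => exact ih₁ I hI (ih₂ I hI)
  | iff_intro _ _ ih₁ ih₂ => exact ⟨ih₁ I hI, ih₂ I hI⟩
  | iff_left _ ih => exact (ih I hI).1
  | iff_right _ ih => exact (ih I hI).2
  | all_intro c hcΓ hcφ _ ih =>
    refine (I.sat_all _ _).2 fun d => (I.sat_update_inst c d _ hcφ).1 (ih _ fun γ hγ => ?_)
    exact (Formula.holds_update I c d _ γ (hcΓ γ hγ)).2 (hI γ hγ)
  | all_elim t _ ih => exact (I.sat_inst _ _).2 ((I.sat_all _ _).1 (ih I hI) _)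
  | ex_intro t _ ih => exact (I.sat_ex _ _).2 ⟨_, (I.sat_inst _ _).1 (ih I hI)⟩
  | ex_elim c hcΓ hcφ hcχ _ _ ih ih' =>
    obtain ⟨d, hd⟩ := (I.sat_ex _ _).1 (ih I hI)
    refine (Formula.holds_update I c d _ _ hcχ).1 (ih' (I.update c d) (hins (fun γ hγ => ?_) ?_))
    · exact (Formula.holds_update I c d _ γ (hcΓ γ hγ)).2 (hI γ hγ)
    · exact (I.sat_update_inst c d _ hcφ).2 hd

/-! ### Soundness of tableaux -/

/-- The conclusions of the arguments in `Γ` whose support is contained in `E`. -/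
def conclusions (E : Set (Element k L)) (Γ : Node k L) : Set (Proposition k L) :=
  {ψ | ∃ S ⊆ E, (S, ψ) ∈ Γ}

theorem conclusions_mono {E E' : Set (Element k L)} {Γ Γ' : Node k L} (hE : E ⊆ E')
    (hΓ : Γ ⊆ Γ') : conclusions E Γ ⊆ conclusions E' Γ' := by
  rintro ψ ⟨S, hS, h⟩
  exact ⟨S, hS.trans hE, hΓ h⟩

theorem conclusions_union (E : Set (Element k L)) (Γ Δ : Node k L) :
    conclusions E (Γ ∪ Δ) = conclusions E Γ ∪ conclusions E Δ := by
  ext ψ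
  simp only [conclusions, Set.mem_ofPred_eq, Set.mem_union, and_or_left, exists_or]

theorem conclusions_finite {E : Set (Element k L)} {Δ : Node k L} (h : Δ.Finite) :
    (conclusions E Δ).Finite := by
  refine (h.image Prod.snd).subset ?_
  rintro ψ ⟨S, -, hS⟩
  exact ⟨_, hS, rfl⟩

theorem conclusions_singleton_subset (E S : Set (Element k L)) (ψ : Proposition k L) :
    conclusions E {(S, ψ)} ⊆ {ψ} := by
  rintro χ ⟨S', -, h⟩
  exact congrArg Prod.snd h

theorem Step.finite {Γ Δ : Node k L} (h : Step Γ Δ) : Δ.Finite := by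
  cases h <;> simp

theorem Split.finite {Γ Δ₁ Δ₂ : Node k L} (h : Split Γ Δ₁ Δ₂) : Δ₁.Finite ∧ Δ₂.Finite := by
  cases h <;> simp

/-- The conclusions of a rule without branching may be discharged. In the rules for `∃` and `¬∀`
they need not follow from the premises, but the eigenconstant is new. -/
theorem Step.derives_bot {Γ Δ : Node k L} (h : Step Γ Δ) {E : Set (Element k L)}
    (hd : Derives (conclusions E (Γ ∪ Δ)) .bot) : Derives (conclusions E Γ) .bot := by
  rw [conclusions_union] at hd
  have hfresh : ∀ {c : L.Const}, ¬ Node.Occurs (.const c) Γ →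
      ∀ γ ∈ conclusions E Γ, ¬ γ.Occurs (.const c) := by
    rintro c hc γ ⟨S, -, hS⟩ ho
    exact hc ⟨_, hS, ho⟩
  have hemp : ∀ {S : Set (Element k L)} {ψ : Proposition k L}, ¬ S ⊆ E →
      conclusions E {(S, ψ)} ⊆ (∅ : Set (Proposition k L)) := by
    rintro S ψ hS χ ⟨S', hS', h'⟩
    exact hS ((congrArg Prod.fst h').ge.trans hS')
  have local_sound : (∀ ψ ∈ conclusions E Δ, Derives (conclusions E Γ) ψ) →
      Derives (conclusions E Γ) .bot := fun H =>
    Derives.cut_finite (conclusions_finite h.finite) H hd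
  cases h with
  | and h =>
    refine local_sound ?_
    rintro ψ ⟨S', hS', ⟨⟨⟩⟩ | ⟨⟨⟩⟩⟩
    · exact .and_left (.hyp ⟨_, hS', h⟩)
    · exact .and_right (.hyp ⟨_, hS', h⟩)
  | iff h =>
    refine local_sound ?_
    rintro ψ ⟨S', hS', ⟨⟨⟩⟩ | ⟨⟨⟩⟩⟩
    · exact .iff_left (.hyp ⟨_, hS', h⟩)
    · exact .iff_right (.hyp ⟨_, hS', h⟩)
  | neg_or h =>
    refine local_sound ?_
    rintro ψ ⟨S', hS', ⟨⟨⟩⟩ | ⟨⟨⟩⟩⟩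
    · exact .neg_intro (.neg_elim (.or_inl (.hyp (.inl rfl))) (.hyp (.inr ⟨_, hS', h⟩)))
    · exact .neg_intro (.neg_elim (.or_inr (.hyp (.inl rfl))) (.hyp (.inr ⟨_, hS', h⟩)))
  | neg_imp h =>
    refine local_sound ?_
    rintro ψ ⟨S', hS', ⟨⟨⟩⟩ | ⟨⟨⟩⟩⟩
    · exact .by_contradiction (.neg_elim
        (.imp_intro (.bot_elim (.neg_elim (.hyp (.inl rfl)) (.hyp (.inr (.inl rfl))))))
        (.hyp (.inr ⟨_, hS', h⟩)))
    · exact .neg_intro (.neg_elim (.imp_intro (.hyp (.inr (.inl rfl))))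
        (.hyp (.inr ⟨_, hS', h⟩)))
  | neg_neg h =>
    refine local_sound ?_
    rintro ψ ⟨S', hS', ⟨⟨⟩⟩⟩
    exact .by_contradiction (.neg_elim (.hyp (.inl rfl)) (.hyp (.inr ⟨_, hS', h⟩)))
  | neg_top h =>
    refine local_sound ?_
    rintro ψ ⟨S', hS', ⟨⟨⟩⟩⟩
    exact .neg_elim .top_intro (.hyp ⟨_, hS', h⟩)
  | close h h' =>
    refine local_sound ?_
    rintro ψ ⟨S', hS', ⟨⟨⟩⟩⟩
    exact .neg_elim (.hyp ⟨_, Set.subset_union_left.trans hS', h⟩)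
      (.hyp ⟨_, Set.subset_union_right.trans hS', h'⟩)
  | all t h ht =>
    refine local_sound ?_
    rintro ψ ⟨S', hS', ⟨⟨⟩⟩⟩
    exact .all_elim t (.hyp ⟨_, hS', h⟩)
  | neg_ex t h ht =>
    refine local_sound ?_
    rintro ψ ⟨S', hS', ⟨⟨⟩⟩⟩
    exact .neg_intro (.neg_elim (.ex_intro t (.hyp (.inl rfl))) (.hyp (.inr ⟨_, hS', h⟩)))
  | @ex S hk φ c h hc =>
    by_cases hS : S ⊆ E
    · refine .ex_elim c (hfresh hc) (fun ho => hc ⟨_, h, ho⟩) id (.hyp ⟨S, hS, h⟩)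
        (.weaken ?_ hd)
      rw [← Set.union_singleton]
      exact Set.union_subset_union_right _ (conclusions_singleton_subset _ _ _)
    · exact .weaken (Set.union_subset subset_rfl ((hemp hS).trans (Set.empty_subset _))) hd
  | @neg_all S hk φ c h hc =>
    by_cases hS : S ⊆ E
    · refine .neg_elim (.all_intro c (hfresh hc) (fun ho => hc ⟨_, h, ho⟩)
        (.by_contradiction (.weaken ?_ hd))) (.hyp ⟨S, hS, h⟩)
      rw [← Set.union_singleton]
      exact Set.union_subset_union_right _ (conclusions_singleton_subset _ _ _)
    · exact .weaken (Set.union_subset subset_rfl ((hemp hS).trans (Set.empty_subset _))) hd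

theorem Split.derives_bot {Γ Δ₁ Δ₂ : Node k L} (h : Split Γ Δ₁ Δ₂) {E : Set (Element k L)}
    (hd₁ : Derives (conclusions E (Γ ∪ Δ₁)) .bot)
    (hd₂ : Derives (conclusions E (Γ ∪ Δ₂)) .bot) : Derives (conclusions E Γ) .bot := by
  have key : ∀ {S : Set (Element k L)} {φ ψ χ : Proposition k L}, Δ₁ = {(S, φ)} →
      Δ₂ = {(S, ψ)} → (S, χ) ∈ Γ → (∀ Γ, Derives Γ χ → Derives Γ (φ.or ψ)) →
      Derives (conclusions E Γ) .bot := by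
    rintro S φ ψ χ rfl rfl hmem H
    rw [conclusions_union] at hd₁ hd₂
    by_cases hS : S ⊆ E
    · refine .or_elim (H _ (.hyp ⟨S, hS, hmem⟩)) (.weaken ?_ hd₁) (.weaken ?_ hd₂)
      all_goals
        rw [← Set.union_singleton]
        exact Set.union_subset_union_right _ (conclusions_singleton_subset _ _ _)
    · refine .weaken (Set.union_subset subset_rfl ?_) hd₁
      rintro χ ⟨S', hS', h'⟩
      exact (hS ((congrArg Prod.fst h').ge.trans hS')).elim
  cases h with
  | or h => exact key rfl rfl h fun _ => id
  | imp h =>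
    refine key rfl rfl h fun Γ hχ => .by_contradiction (.neg_elim (.or_inl (.neg_intro ?_))
      (.hyp (.inl rfl)))
    refine .neg_elim (.or_inr (.imp_elim (.weaken ?_ hχ) (.hyp (.inl rfl)))) (.hyp (.inr (.inl rfl)))
    exact fun x hx => .inr (.inr hx)
  | neg_and h =>
    refine key rfl rfl h fun Γ hχ => .by_contradiction (.neg_elim (.or_inl (.neg_intro ?_))
      (.hyp (.inl rfl)))
    refine .neg_elim (.or_inr (.neg_intro (.neg_elim
      (.and_intro (.hyp (.inr (.inl rfl))) (.hyp (.inl rfl))) (.weaken ?_ hχ))))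
      (.hyp (.inr (.inl rfl)))
    exact fun x hx => .inr (.inr (.inr hx))
  | neg_iff h =>
    refine key rfl rfl h fun Γ hχ => .by_contradiction (.neg_elim (.or_inl (.neg_intro ?_))
      (.hyp (.inl rfl)))
    refine .neg_elim (.or_inr (.neg_intro (.neg_elim
      (.iff_intro (.hyp (.inr (.inl rfl))) (.hyp (.inl rfl))) (.weaken ?_ hχ))))
      (.hyp (.inr (.inl rfl)))
    exact fun x hx => .inr (.inr (.inr hx))

namespace Tableau

theorem isClosureSupport_leaf {Γ : Node k L} {S : Set (Element k L)} :
    (leaf Γ).IsClosureSupport S ↔ (S, Formula.bot) ∈ Γ := by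
  constructor
  · rintro ⟨Ss, h, rfl⟩
    rw [leaves, List.forall₂_cons_right_iff] at h
    obtain ⟨S, l, hS, hl, rfl⟩ := h
    rw [List.forall₂_nil_right_iff] at hl
    subst hl
    simpa using hS
  · intro h
    exact ⟨[S], .cons h .nil, by simp⟩

theorem isClosureSupport_split {Γ Δ₁ Δ₂ : Node k L} (h : Split Γ Δ₁ Δ₂) (T₁ : Tableau (Γ ∪ Δ₁))
    (T₂ : Tableau (Γ ∪ Δ₂)) {S : Set (Element k L)} :
    (split h T₁ T₂).IsClosureSupport S ↔
      ∃ S₁ S₂, T₁.IsClosureSupport S₁ ∧ T₂.IsClosureSupport S₂ ∧ S = S₁ ∪ S₂ := by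
  constructor
  · rintro ⟨Ss, h, rfl⟩
    rw [leaves] at h
    refine ⟨_, _, ⟨_, List.forall₂_take_append _ _ _ h, rfl⟩,
      ⟨_, List.forall₂_drop_append _ _ _ h, rfl⟩, ?_⟩
    conv_lhs => rw [← List.take_append_drop T₁.leaves.length Ss]
    simp only [List.mem_append, Set.iUnion_or, Set.iUnion_union_distrib]
  · rintro ⟨_, _, ⟨l₁, h₁, rfl⟩, ⟨l₂, h₂, rfl⟩, rfl⟩
    refine ⟨l₁ ++ l₂, List.rel_append h₁ h₂, ?_⟩
    simp only [List.mem_append, Set.iUnion_or, Set.iUnion_union_distrib]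

theorem IsClosureSupport.derives_bot {Γ : Node k L} {T : Tableau Γ} {S : Set (Element k L)}
    (h : T.IsClosureSupport S) : Derives (conclusions S Γ) .bot := by
  induction T generalizing S with
  | leaf Γ => exact .hyp ⟨S, subset_rfl, isClosureSupport_leaf.1 h⟩
  | step hs T ih => exact hs.derives_bot (ih h)
  | split hs T₁ T₂ ih₁ ih₂ =>
    obtain ⟨S₁, S₂, h₁, h₂, rfl⟩ := (isClosureSupport_split _ _ _).1 h
    exact hs.derives_bot
      (.weaken (conclusions_mono Set.subset_union_left subset_rfl) (ih₁ h₁))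
      (.weaken (conclusions_mono Set.subset_union_right subset_rfl) (ih₂ h₂))

end Tableau

/-! ### Hintikka sets and their Herbrand models -/

/-- The set `H` contains the conclusions of the tableau rule for `φ` (of one of its branches), if
there is one that does not involve a choice of a ground term. -/
def Expanded (H : Set (Proposition k L)) : Proposition k L → Prop
  | .and φ ψ => φ ∈ H ∧ ψ ∈ H
  | .or φ ψ => φ ∈ H ∨ ψ ∈ H
  | .imp φ ψ => φ.neg ∈ H ∨ ψ ∈ H
  | .iff φ ψ => φ.imp ψ ∈ H ∧ ψ.imp φ ∈ H
  | .ex _ φ => ∃ c, φ.inst (.const c) ∈ H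
  | .neg .top => .bot ∈ H
  | .neg (.neg φ) => φ ∈ H
  | .neg (.and φ ψ) => φ.neg ∈ H ∨ ψ.neg ∈ H
  | .neg (.or φ ψ) => φ.neg ∈ H ∧ ψ.neg ∈ H
  | .neg (.imp φ ψ) => φ ∈ H ∧ ψ.neg ∈ H
  | .neg (.iff φ ψ) => (φ.imp ψ).neg ∈ H ∨ (ψ.imp φ).neg ∈ H
  | .neg (.all _ φ) => ∃ c, (φ.inst (.const c)).neg ∈ H
  | _ => True

/-- If `φ` is universal or the negation of an existential proposition, then `H` contains its
instance at `t`. -/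
def InstantiatedAt (H : Set (Proposition k L)) (t : Term L 0) : Proposition k L → Prop
  | .all _ φ => φ.inst t ∈ H
  | .neg (.ex _ φ) => (φ.inst t).neg ∈ H
  | _ => True

theorem Expanded.mono {H H' : Set (Proposition k L)} (hH : H ⊆ H') {φ : Proposition k L}
    (h : Expanded H φ) : Expanded H' φ := by
  unfold Expanded at h ⊢
  split at h
  case h_1 | h_4 | h_9 | h_10 => exact h.imp (@hH _) (@hH _)
  case h_2 | h_3 | h_8 | h_11 => exact h.imp (@hH _) (@hH _)
  case h_5 | h_12 => exact h.imp fun _ => @hH _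
  case h_6 | h_7 => exact hH h
  case h_13 => trivial

theorem InstantiatedAt.mono {H H' : Set (Proposition k L)} (hH : H ⊆ H') {t : Term L 0}
    {φ : Proposition k L} (h : InstantiatedAt H t φ) : InstantiatedAt H' t φ := by
  unfold InstantiatedAt at h ⊢
  split at h
  case h_1 | h_2 => exact hH h
  case h_3 => trivial

/-- A Hintikka set `H` whose quantifiers range over the set `D` of ground terms. The set `D` may be
empty only if the language has no ground terms. -/
structure IsHintikka (H : Set (Proposition k L)) (D : Set (Term L 0)) : Prop where
  bot_notMem : .bot ∉ H
  neg_notMem : ∀ φ ∈ H, φ.neg ∉ H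
  expanded : ∀ φ ∈ H, Expanded H φ
  instantiatedAt : ∀ φ ∈ H, ∀ t ∈ D, InstantiatedAt H t φ
  mem_of_occurs : ∀ φ ∈ H, ∀ t, φ.Occurs t → t ∈ D
  mem_of_hasSubterm : ∀ t ∈ D, ∀ s, t.HasSubterm s → s ∈ D
  nonempty : L.Const → D.Nonempty

/-- The number of logical symbols of a formula, with `↔` counted twice, so that the rule for `↔`
leads to formulas of smaller rank. -/
def Formula.rank : {n : ℕ} → Formula k L n → ℕ
  | _, atom _ _ => 0
  | _, top => 0
  | _, bot => 0
  | _, neg φ => φ.rank + 1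
  | _, and φ ψ => φ.rank + ψ.rank + 1
  | _, or φ ψ => φ.rank + ψ.rank + 1
  | _, imp φ ψ => φ.rank + ψ.rank + 1
  | _, iff φ ψ => φ.rank + ψ.rank + 2
  | _, all _ φ => φ.rank + 1
  | _, ex _ φ => φ.rank + 1

theorem Formula.rank_subst {n m : ℕ} (s : Fin n → Term L m) (φ : Formula k L n) :
    (φ.subst s).rank = φ.rank := by
  induction φ generalizing m with
  | atom | top | bot => rfl
  | neg φ ih | all _ φ ih | ex _ φ ih => simp only [subst, rank, ih]
  | and φ ψ ih₁ ih₂ | or φ ψ ih₁ ih₂ | imp φ ψ ih₁ ih₂ | iff φ ψ ih₁ ih₂ =>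
    simp only [subst, rank, ih₁, ih₂]

theorem Formula.rank_inst (φ : Formula k L 1) (t : Term L 0) : (φ.inst t).rank = φ.rank :=
  φ.rank_subst _

namespace IsHintikka

variable {H : Set (Proposition k L)} {D : Set (Term L 0)}

open Classical in
/-- The Herbrand model with domain `D`. Constants outside `D` denote an arbitrary element of the
domain; so does `f(t₁, …, tₘ)` if it is not in `D`, and the first argument serves as this element. -/
noncomputable def herbrand (h : IsHintikka H D) : Interp L D where
  const c := if hc : .const c ∈ D then ⟨.const c, hc⟩ else
    ⟨(h.nonempty c).some, (h.nonempty c).some_mem⟩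
  func f d := if hd : .app f (fun j => (d j).1) ∈ D then ⟨.app f (fun j => (d j).1), hd⟩ else d 0
  pred P d := .atom P (fun j => (d j).1) ∈ H

theorem eval_herbrand (h : IsHintikka H D) (a : Fin 0 → D) (t : Term L 0) (ht : t ∈ D) :
    t.eval h.herbrand a = ⟨t, ht⟩ := by
  induction t with
  | const c => simp only [Term.eval, herbrand, dif_pos ht]
  | bvar i => exact i.elim0
  | app f ts ih =>
    have : ∀ j, ts j ∈ D := fun j => h.mem_of_hasSubterm _ ht _ (.arg f ts j (.refl _))
    simp only [Term.eval]
    rw [funext fun j => ih j (this j)]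
    exact dif_pos ht

theorem herbrand_pred (h : IsHintikka H D) {m : ℕ} (P : L.Pred m) (ts : Fin m → Term L 0)
    (ht : ∀ j, ts j ∈ D) : h.herbrand.Sat (.atom P ts : Proposition k L) ↔ .atom P ts ∈ H := by
  simp only [Interp.Sat, Formula.Holds]
  rw [funext fun j => h.eval_herbrand _ (ts j) (ht j)]
  rfl

theorem herbrand_inst (h : IsHintikka H D) (φ : Formula k L 1) (d : D) :
    h.herbrand.Sat (φ.inst d.1) ↔ φ.Holds h.herbrand (fun _ => d) := by
  rw [Interp.sat_inst, h.eval_herbrand _ d.1 d.2]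

/-- The arguments of an atom that is in `H`, or whose negation is, belong to `D`. -/
theorem mem_of_atom (h : IsHintikka H D) {φ : Proposition k L} (hφ : φ ∈ H) {m : ℕ} {P : L.Pred m}
    {ts : Fin m → Term L 0} (j : Fin m) (ho : ∀ t, (Formula.atom P ts : Proposition k L).Occurs t →
    φ.Occurs t) : ts j ∈ D :=
  h.mem_of_occurs _ hφ _ (ho _ ⟨j, by rw [Term.ofGround_ground]; exact .refl _⟩)

/-- A Hintikka set is true in its Herbrand model, by induction on the rank. -/
theorem herbrand_sat (h : IsHintikka H D) : ∀ φ ∈ H, h.herbrand.Sat φ := by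
  have key : ∀ N, ∀ φ : Proposition k L, φ.rank < N →
      (φ ∈ H → h.herbrand.Sat φ) ∧ (φ.neg ∈ H → ¬ h.herbrand.Sat φ) := by
    intro N
    induction N with
    | zero => exact fun φ hφ => absurd hφ (Nat.not_lt_zero _)
    | succ N ih =>
      intro φ hφ
      have he := h.expanded φ
      have hn := h.expanded φ.neg
      cases φ with
      | atom P ts =>
        refine ⟨fun hm => ?_, fun hm hs => ?_⟩
        · exact (h.herbrand_pred P ts fun j => h.mem_of_atom hm j fun _ => id).2 hm
        · exact h.neg_notMem _
            ((h.herbrand_pred P ts fun j => h.mem_of_atom hm j fun _ => id).1 hs) hm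
      | top => exact ⟨fun _ => trivial, fun hm _ => h.bot_notMem (hn hm)⟩
      | bot => exact ⟨fun hm => (h.bot_notMem hm).elim, fun _ hs => hs⟩
      | neg φ =>
        have h₁ := ih φ (by simp only [Formula.rank] at hφ; omega)
        exact ⟨h₁.2, fun hm hs => hs (h₁.1 (hn hm))⟩
      | and φ ψ =>
        have h₁ := ih φ (by simp only [Formula.rank] at hφ; omega)
        have h₂ := ih ψ (by simp only [Formula.rank] at hφ; omega)
        exact ⟨fun hm => (he hm).imp h₁.1 h₂.1, fun hm hs =>
          (hn hm).elim (fun h' => h₁.2 h' hs.1) fun h' => h₂.2 h' hs.2⟩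
      | or φ ψ =>
        have h₁ := ih φ (by simp only [Formula.rank] at hφ; omega)
        have h₂ := ih ψ (by simp only [Formula.rank] at hφ; omega)
        exact ⟨fun hm => (he hm).imp h₁.1 h₂.1, fun hm hs =>
          hs.elim (h₁.2 (hn hm).1) (h₂.2 (hn hm).2)⟩
      | imp φ ψ =>
        have h₁ := ih φ (by simp only [Formula.rank] at hφ; omega)
        have h₂ := ih ψ (by simp only [Formula.rank] at hφ; omega)
        exact ⟨fun hm hs => (he hm).elim (fun h' => (h₁.2 h' hs).elim) h₂.1, fun hm hs =>
          h₂.2 (hn hm).2 (hs (h₁.1 (hn hm).1))⟩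
      | iff φ ψ =>
        have h₁ := ih (φ.imp ψ) (by simp only [Formula.rank] at hφ ⊢; omega)
        have h₂ := ih (ψ.imp φ) (by simp only [Formula.rank] at hφ ⊢; omega)
        exact ⟨fun hm => ⟨h₁.1 (he hm).1, h₂.1 (he hm).2⟩, fun hm hs =>
          (hn hm).elim (fun h' => h₁.2 h' hs.1) fun h' => h₂.2 h' hs.2⟩
      | all hk φ =>
        have h₁ : ∀ t, _ := fun t =>
          ih (φ.inst t) (by simp only [Formula.rank, Formula.rank_inst] at hφ ⊢; omega)
        refine ⟨fun hm => ?_, fun hm hs => ?_⟩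
        · exact (Interp.sat_all _ _ _).2 fun d =>
            (h.herbrand_inst φ d).1 ((h₁ d.1).1 (h.instantiatedAt _ hm d.1 d.2))
        · obtain ⟨c, hc⟩ := hn hm
          exact (h₁ _).2 hc ((Interp.sat_inst _ _ _).2 ((Interp.sat_all _ _ _).1 hs _))
      | ex hk φ =>
        have h₁ : ∀ t, _ := fun t =>
          ih (φ.inst t) (by simp only [Formula.rank, Formula.rank_inst] at hφ ⊢; omega)
        refine ⟨fun hm => ?_, fun hm hs => ?_⟩
        · obtain ⟨c, hc⟩ := he hm
          exact (Interp.sat_ex _ _ _).2 ⟨_, (Interp.sat_inst _ _ _).1 ((h₁ _).1 hc)⟩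
        · obtain ⟨d, hd⟩ := (Interp.sat_ex _ _ _).1 hs
          exact (h₁ d.1).2 (h.instantiatedAt _ hm d.1 d.2) ((h.herbrand_inst φ d).2 hd)
  exact fun φ hφ => (key _ φ (Nat.lt_succ_self _)).1 hφ

end IsHintikka

/-! ### Open nodes and their saturation -/

/-- The node `Γ` is the root of a tableau with a support for its closure that is contained
in `E`. -/
def Closable (E : Set (Element k L)) (Γ : Node k L) : Prop :=
  ∃ T : Tableau Γ, ∃ S ⊆ E, T.IsClosureSupport S

theorem Closable.of_bot_mem {E : Set (Element k L)} {Γ : Node k L}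
    (h : .bot ∈ conclusions E Γ) : Closable E Γ := by
  obtain ⟨S, hS, hb⟩ := h
  exact ⟨.leaf Γ, S, hS, Tableau.isClosureSupport_leaf.2 hb⟩

theorem Closable.step {E : Set (Element k L)} {Γ Δ : Node k L} (hs : Step Γ Δ)
    (h : Closable E (Γ ∪ Δ)) : Closable E Γ := by
  obtain ⟨T, S, hS, h⟩ := h
  exact ⟨.step hs T, S, hS, h⟩

theorem Closable.split {E : Set (Element k L)} {Γ Δ₁ Δ₂ : Node k L} (hs : Split Γ Δ₁ Δ₂)
    (h₁ : Closable E (Γ ∪ Δ₁)) (h₂ : Closable E (Γ ∪ Δ₂)) : Closable E Γ := by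
  obtain ⟨T₁, S₁, hS₁, h₁⟩ := h₁
  obtain ⟨T₂, S₂, hS₂, h₂⟩ := h₂
  exact ⟨.split hs T₁ T₂, S₁ ∪ S₂, Set.union_subset hS₁ hS₂,
    (Tableau.isClosureSupport_split _ _ _).2 ⟨S₁, S₂, h₁, h₂, rfl⟩⟩

/-- The finiteness conditions under which a node can be saturated: finitely many conclusions with
support in `E`, and, in predicate logic, infinitely many new constants. -/
structure Saturable (E : Set (Element k L)) (Γ : Node k L) : Prop where
  finite : (conclusions E Γ).Finite
  fresh : k = .predicate → {c : L.Const | ¬ Node.Occurs (.const c) Γ}.Infinite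

theorem Saturable.union {E : Set (Element k L)} {Γ Δ : Node k L} (h : Saturable E Γ)
    (hΔ : Δ.Finite) : Saturable E (Γ ∪ Δ) where
  finite := by
    rw [conclusions_union]
    exact h.finite.union (conclusions_finite hΔ)
  fresh hk := by
    have hfin : {c : L.Const | Node.Occurs (.const c) Δ}.Finite := by
      have hinj : Function.Injective (Term.const : L.Const → Term L 0) := fun _ _ h => by
        injection h
      refine (hΔ.biUnion fun A _ => (A.2.finite_occurs).preimage hinj.injOn).subset ?_
      rintro c ⟨A, hA, hc⟩
      exact Set.mem_biUnion hA hc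
    refine ((h.fresh hk).sdiff hfin).mono ?_
    rintro c ⟨hc, hc'⟩ ⟨A, hA | hA, ho⟩
    · exact hc ⟨A, hA, ho⟩
    · exact hc' ⟨A, hA, ho⟩

/-- A node that satisfies the finiteness conditions and cannot be closed with support in `E`. -/
structure IsOpenNode (E : Set (Element k L)) (Γ : Node k L) : Prop extends Saturable E Γ where
  not_closable : ¬ Closable E Γ

/-- The ground terms that occur in the conclusions with support in `E`, and the constants in `C`:
a round of the saturation instantiates at these terms. -/
def herbrandTerms (E : Set (Element k L)) (C : Set L.Const) (Γ : Node k L) :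
    Set (Term L 0) :=
  {t | ∃ φ ∈ conclusions E Γ, φ.Occurs t} ∪ .const '' C

namespace IsOpenNode

variable {E : Set (Element k L)} {Γ Δ Δ₁ Δ₂ : Node k L}

theorem step (h : IsOpenNode E Γ) (hs : Step Γ Δ) : IsOpenNode E (Γ ∪ Δ) :=
  ⟨h.union hs.finite, fun hc => h.not_closable (hc.step hs)⟩

theorem split (h : IsOpenNode E Γ) (hs : Split Γ Δ₁ Δ₂) :
    IsOpenNode E (Γ ∪ Δ₁) ∨ IsOpenNode E (Γ ∪ Δ₂) := by
  by_contra! hn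
  refine h.not_closable (.split hs ?_ ?_)
  · by_contra hc
    exact hn.1 ⟨h.union hs.finite.1, hc⟩
  · by_contra hc
    exact hn.2 ⟨h.union hs.finite.2, hc⟩

theorem bot_notMem (h : IsOpenNode E Γ) : .bot ∉ conclusions E Γ :=
  fun hb => h.not_closable (.of_bot_mem hb)

theorem neg_notMem (h : IsOpenNode E Γ) {φ : Proposition k L} (hφ : φ ∈ conclusions E Γ) :
    φ.neg ∉ conclusions E Γ := by
  rintro ⟨S', hS', h'⟩
  obtain ⟨S, hS, hφ⟩ := hφ
  exact (h.step (.close hφ h')).bot_notMem ⟨_, Set.union_subset hS hS', Or.inr rfl⟩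

theorem exists_expanded (h : IsOpenNode E Γ) {φ : Proposition k L} (hφ : φ ∈ conclusions E Γ) :
    ∃ Γ', Γ ⊆ Γ' ∧ IsOpenNode E Γ' ∧ Expanded (conclusions E Γ') φ := by
  obtain ⟨S, hS, hφ⟩ := hφ
  have hstep : ∀ {Δ : Node k L}, Step Γ Δ → Expanded (conclusions E (Γ ∪ Δ)) φ →
      ∃ Γ', Γ ⊆ Γ' ∧ IsOpenNode E Γ' ∧ Expanded (conclusions E Γ') φ :=
    fun hs he => ⟨_, Set.subset_union_left, h.step hs, he⟩
  have hsplit : ∀ {Δ₁ Δ₂ : Node k L}, Split Γ Δ₁ Δ₂ → Expanded (conclusions E (Γ ∪ Δ₁)) φ →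
      Expanded (conclusions E (Γ ∪ Δ₂)) φ →
      ∃ Γ', Γ ⊆ Γ' ∧ IsOpenNode E Γ' ∧ Expanded (conclusions E Γ') φ :=
    fun hs he₁ he₂ => (h.split hs).elim (fun h' => ⟨_, Set.subset_union_left, h', he₁⟩)
      fun h' => ⟨_, Set.subset_union_left, h', he₂⟩
  have one : ∀ {ψ : Proposition k L}, ψ ∈ conclusions E (Γ ∪ {(S, ψ)}) :=
    ⟨S, hS, Or.inr rfl⟩
  have left : ∀ {ψ χ : Proposition k L}, ψ ∈ conclusions E (Γ ∪ {(S, ψ), (S, χ)}) :=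
    ⟨S, hS, Or.inr (Or.inl rfl)⟩
  have right : ∀ {ψ χ : Proposition k L}, χ ∈ conclusions E (Γ ∪ {(S, ψ), (S, χ)}) :=
    ⟨S, hS, Or.inr (Or.inr rfl)⟩
  cases φ with
  | atom | top | bot | all => exact ⟨Γ, subset_rfl, h, trivial⟩
  | and φ ψ => exact hstep (.and hφ) ⟨left, right⟩
  | or φ ψ => exact hsplit (.or hφ) (Or.inl one) (Or.inr one)
  | imp φ ψ => exact hsplit (.imp hφ) (Or.inl one) (Or.inr one)
  | iff φ ψ => exact hstep (.iff hφ) ⟨left, right⟩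
  | ex hk φ =>
    obtain ⟨c, hc⟩ := (h.fresh hk).nonempty
    exact hstep (.ex c hφ hc) ⟨c, one⟩
  | neg φ =>
    cases φ with
    | atom | bot | ex => exact ⟨Γ, subset_rfl, h, trivial⟩
    | top => exact hstep (.neg_top hφ) one
    | neg φ => exact hstep (.neg_neg hφ) one
    | and φ ψ => exact hsplit (.neg_and hφ) (Or.inl one) (Or.inr one)
    | or φ ψ => exact hstep (.neg_or hφ) ⟨left, right⟩
    | imp φ ψ => exact hstep (.neg_imp hφ) ⟨left, right⟩
    | iff φ ψ => exact hsplit (.neg_iff hφ) (Or.inl one) (Or.inr one)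
    | all hk φ =>
      obtain ⟨c, hc⟩ := (h.fresh hk).nonempty
      exact hstep (.neg_all c hφ hc) ⟨c, one⟩

theorem exists_instantiatedAt (h : IsOpenNode E Γ) {φ : Proposition k L}
    (hφ : φ ∈ conclusions E Γ) {t : Term L 0} (ht : Node.Available Γ t) :
    ∃ Γ', Γ ⊆ Γ' ∧ IsOpenNode E Γ' ∧ InstantiatedAt (conclusions E Γ') t φ := by
  obtain ⟨S, hS, hφ⟩ := hφ
  unfold InstantiatedAt
  split
  · exact ⟨_, Set.subset_union_left, h.step (.all t hφ ht), S, hS, Or.inr rfl⟩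
  · exact ⟨_, Set.subset_union_left, h.step (.neg_ex t hφ ht), S, hS, Or.inr rfl⟩
  · exact ⟨Γ, subset_rfl, h, trivial⟩

/-- Finitely many monotone requirements can be met one after the other. -/
theorem exists_forall_of_finite {ι : Type*} {s : Set ι} (hs : s.Finite) {R : ι → Node k L → Prop}
    (hmono : ∀ i Γ Γ', Γ ⊆ Γ' → R i Γ → R i Γ')
    (hR : ∀ i ∈ s, ∀ Γ', Γ ⊆ Γ' → IsOpenNode E Γ' → ∃ Γ'', Γ' ⊆ Γ'' ∧ IsOpenNode E Γ'' ∧ R i Γ'')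
    (h : IsOpenNode E Γ) : ∃ Γ', Γ ⊆ Γ' ∧ IsOpenNode E Γ' ∧ ∀ i ∈ s, R i Γ' := by
  induction s, hs using Set.Finite.induction_on with
  | empty => exact ⟨Γ, subset_rfl, h, fun i hi => hi.elim⟩
  | @insert a s _ _ ih =>
    obtain ⟨Γ₁, hs₁, h₁, hR₁⟩ := ih fun i hi => hR i (Set.mem_insert_of_mem _ hi)
    obtain ⟨Γ₂, hs₂, h₂, hR₂⟩ := hR a (Set.mem_insert _ _) Γ₁ hs₁ h₁
    refine ⟨Γ₂, hs₁.trans hs₂, h₂, ?_⟩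
    rintro i (rfl | hi)
    · exact hR₂
    · exact hmono i _ _ hs₂ (hR₁ i hi)

/-- Every open node extends to an open node with a set `C` of constants, nonempty if there are
any constants, that remain available in all larger open nodes. A constant that occurs in a node has
this property; if constants occur in no open extension at all, then every constant has it. -/
theorem exists_available (h : IsOpenNode E Γ) :
    ∃ Γ', Γ ⊆ Γ' ∧ IsOpenNode E Γ' ∧ ∃ C : Set L.Const, C.Finite ∧ (L.Const → C.Nonempty) ∧
      ∀ Γ'', Γ' ⊆ Γ'' → IsOpenNode E Γ'' → ∀ c ∈ C, Node.Available Γ'' (.const c) := by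
  by_cases hocc : ∃ Γ', Γ ⊆ Γ' ∧ IsOpenNode E Γ' ∧ ∃ c : L.Const, Node.Occurs (.const c) Γ'
  · obtain ⟨Γ', hs, h', c, A, hA, hc⟩ := hocc
    refine ⟨Γ', hs, h', {c}, Set.finite_singleton c, fun _ => Set.singleton_nonempty c, ?_⟩
    rintro Γ'' hs'' - _ rfl
    exact Or.inl ⟨A, hs'' hA, hc⟩
  · have hnone : ∀ Γ', Γ ⊆ Γ' → IsOpenNode E Γ' → ∀ s : Term L 0, ¬ Node.Occurs s Γ' := by
      rintro Γ' hs h' s ⟨A, hA, hA'⟩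
      obtain ⟨c, hc⟩ := s.exists_const_hasSubterm
      exact hocc ⟨Γ', hs, h', c, A, hA, hA'.of_hasSubterm hc⟩
    rcases isEmpty_or_nonempty L.Const with he | ⟨⟨c⟩⟩
    · exact ⟨Γ, subset_rfl, h, ∅, Set.finite_empty, fun c => (he.false c).elim,
        fun _ _ _ c hc => hc.elim⟩
    · refine ⟨Γ, subset_rfl, h, {c}, Set.finite_singleton c, fun _ => Set.singleton_nonempty c, ?_⟩
      exact fun Γ'' hs h'' c _ => Or.inr ⟨hnone Γ'' hs h'', c, rfl⟩

/-- One round of the saturation treats all of the finitely many conclusions of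
`Γ` with support in `E`, so that no fair enumeration of formulas is needed and the language may be
uncountable. -/
theorem exists_round (h : IsOpenNode E Γ) {C : Set L.Const} (hfin : C.Finite)
    (hC : ∀ Γ', Γ ⊆ Γ' → IsOpenNode E Γ' → ∀ c ∈ C, Node.Available Γ' (.const c)) :
    ∃ Γ', Γ ⊆ Γ' ∧ IsOpenNode E Γ' ∧ ∀ φ ∈ conclusions E Γ, Expanded (conclusions E Γ') φ ∧
      ∀ t ∈ herbrandTerms E C Γ, InstantiatedAt (conclusions E Γ') t φ := by
  have hD : (herbrandTerms E C Γ).Finite := by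
    refine Set.Finite.union ?_ (hfin.image _)
    refine (h.finite.biUnion fun φ _ => φ.finite_occurs).subset ?_
    rintro t ⟨φ, hφ, ht⟩
    exact Set.mem_biUnion hφ ht
  have hav : ∀ Γ', Γ ⊆ Γ' → IsOpenNode E Γ' → ∀ t ∈ herbrandTerms E C Γ,
      Node.Available Γ' t := by
    rintro Γ' hs h' t (⟨φ, ⟨S, -, hφ⟩, ht⟩ | ⟨c, hc, rfl⟩)
    · exact Or.inl ⟨_, hs hφ, ht⟩
    · exact hC Γ' hs h' c hc
  obtain ⟨Γ₁, hs₁, h₁, he₁⟩ := exists_forall_of_finite h.finite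
    (R := fun φ Γ' => Expanded (conclusions E Γ') φ)
    (fun _ _ _ hs he => he.mono (conclusions_mono subset_rfl hs))
    (fun φ hφ Γ' hs h' => h'.exists_expanded (conclusions_mono subset_rfl hs hφ)) h
  obtain ⟨Γ₂, hs₂, h₂, he₂⟩ := exists_forall_of_finite (h.finite.prod hD)
    (R := fun p Γ' => InstantiatedAt (conclusions E Γ') p.2 p.1)
    (fun _ _ _ hs he => he.mono (conclusions_mono subset_rfl hs))
    (fun p hp Γ' hs h' => h'.exists_instantiatedAt
      (conclusions_mono subset_rfl (hs₁.trans hs) hp.1) (hav Γ' (hs₁.trans hs) h' _ hp.2)) h₁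
  exact ⟨Γ₂, hs₁.trans hs₂, h₂, fun φ hφ =>
    ⟨(he₁ φ hφ).mono (conclusions_mono subset_rfl hs₂), fun t ht => he₂ (φ, t) ⟨hφ, ht⟩⟩⟩

/-- The union of a sequence of rounds is a Hintikka set. -/
theorem exists_isHintikka (h : IsOpenNode E Γ) :
    ∃ H D, conclusions E Γ ⊆ H ∧ IsHintikka H D := by
  obtain ⟨Γ₀, hs₀, h₀, C, hfin, hne, hC⟩ := h.exists_available
  have hround : ∀ G : {Γ' // Γ₀ ⊆ Γ' ∧ IsOpenNode E Γ'}, ∃ G' : {Γ' // Γ₀ ⊆ Γ' ∧ IsOpenNode E Γ'},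
      G.1 ⊆ G'.1 ∧ ∀ φ ∈ conclusions E G.1, Expanded (conclusions E G'.1) φ ∧
        ∀ t ∈ herbrandTerms E C G.1, InstantiatedAt (conclusions E G'.1) t φ := by
    rintro ⟨Γ₁, hs₁, h₁⟩
    obtain ⟨Γ₂, hs₂, h₂, he⟩ := h₁.exists_round hfin fun Γ' hs => hC Γ' (hs₁.trans hs)
    exact ⟨⟨Γ₂, hs₁.trans hs₂, h₂⟩, hs₂, he⟩
  choose next hnext hdone using hround
  let G : ℕ → {Γ' // Γ₀ ⊆ Γ' ∧ IsOpenNode E Γ'} := fun n => next^[n] ⟨Γ₀, subset_rfl, h₀⟩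
  have hsucc : ∀ n, G (n + 1) = next (G n) := fun n => Function.iterate_succ_apply' _ _ _
  have hmono : Monotone fun n => (G n).1 := monotone_nat_of_le_succ fun n => by
    rw [hsucc]
    exact hnext _
  have hcon : Monotone fun n => conclusions E (G n).1 := fun m n hmn =>
    conclusions_mono subset_rfl (hmono hmn)
  have hterms : Monotone fun n => herbrandTerms E C (G n).1 := fun m n hmn =>
    Set.union_subset_union_left _ fun t ⟨φ, hφ, ht⟩ => ⟨φ, hcon hmn hφ, ht⟩
  have hsub : ∀ n, conclusions E (G n).1 ⊆ ⋃ n, conclusions E (G n).1 :=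
    Set.subset_iUnion fun n => conclusions E (G n).1
  refine ⟨⋃ n, conclusions E (G n).1, ⋃ n, herbrandTerms E C (G n).1,
    (conclusions_mono subset_rfl hs₀).trans (hsub 0), ?_, ?_, ?_, ?_, ?_, ?_, ?_⟩
  · intro hb
    obtain ⟨n, hn⟩ := Set.mem_iUnion.1 hb
    exact (G n).2.2.bot_notMem hn
  · intro φ hφ hφ'
    obtain ⟨n, hn⟩ := Set.mem_iUnion.1 hφ
    obtain ⟨m, hm⟩ := Set.mem_iUnion.1 hφ'
    exact (G (max n m)).2.2.neg_notMem (hcon (le_max_left n m) hn) (hcon (le_max_right n m) hm)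
  · intro φ hφ
    obtain ⟨n, hn⟩ := Set.mem_iUnion.1 hφ
    refine Expanded.mono (hsub (n + 1)) ?_
    rw [hsucc]
    exact (hdone _ φ hn).1
  · intro φ hφ t ht
    obtain ⟨n, hn⟩ := Set.mem_iUnion.1 hφ
    obtain ⟨m, hm⟩ := Set.mem_iUnion.1 ht
    refine InstantiatedAt.mono (hsub (max n m + 1)) ?_
    rw [hsucc]
    exact (hdone _ φ (hcon (le_max_left n m) hn)).2 t (hterms (le_max_right n m) hm)
  · intro φ hφ t ht
    obtain ⟨n, hn⟩ := Set.mem_iUnion.1 hφ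
    exact Set.mem_iUnion.2 ⟨n, Or.inl ⟨φ, hn, ht⟩⟩
  · intro t ht s hs
    obtain ⟨n, ⟨φ, hφ, ht⟩ | ⟨c, hc, rfl⟩⟩ := Set.mem_iUnion.1 ht
    · exact Set.mem_iUnion.2 ⟨n, Or.inl ⟨φ, hφ, ht.of_hasSubterm hs⟩⟩
    · cases hs
      exact Set.mem_iUnion.2 ⟨n, Or.inr ⟨c, hc, rfl⟩⟩
  · intro c
    obtain ⟨c', hc'⟩ := hne c
    exact ⟨.const c', Set.mem_iUnion.2 ⟨0, Or.inr ⟨c', hc', rfl⟩⟩⟩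

end IsOpenNode

/-! ### Completeness of tableaux -/

theorem Saturable.closable {E : Set (Element k L)} {Γ : Node k L} (h : Saturable E Γ)
    (hd : Derives (conclusions E Γ) .bot) : Closable E Γ := by
  by_contra hn
  obtain ⟨H, D, hsub, hH⟩ := IsOpenNode.exists_isHintikka ⟨h, hn⟩
  exact hd.sound hH.herbrand fun φ hφ => hH.herbrand_sat φ (hsub hφ)

theorem Tableau.exists_extends_isClosureSupport {E : Set (Element k L)} {Γ : Node k L}
    (T : Tableau Γ) (h : Saturable E Γ) (hd : Derives (conclusions E Γ) .bot) :
    ∃ T' : Tableau Γ, T.Extends T' ∧ ∃ S ⊆ E, T'.IsClosureSupport S := by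
  induction T with
  | leaf Γ =>
    obtain ⟨T', hT'⟩ := h.closable hd
    exact ⟨T', .leaf T', hT'⟩
  | step hs T ih =>
    obtain ⟨T', he, S, hS, h'⟩ := ih (h.union hs.finite)
      (.weaken (conclusions_mono subset_rfl Set.subset_union_left) hd)
    exact ⟨.step hs T', .step hs he, S, hS, h'⟩
  | split hs T₁ T₂ ih₁ ih₂ =>
    obtain ⟨T₁', he₁, S₁, hS₁, h₁⟩ := ih₁ (h.union hs.finite.1)
      (.weaken (conclusions_mono subset_rfl Set.subset_union_left) hd)
    obtain ⟨T₂', he₂, S₂, hS₂, h₂⟩ := ih₂ (h.union hs.finite.2)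
      (.weaken (conclusions_mono subset_rfl Set.subset_union_left) hd)
    exact ⟨.split hs T₁' T₂', .split hs he₁ he₂, S₁ ∪ S₂, Set.union_subset hS₁ hS₂,
      (isClosureSupport_split _ _ _).2 ⟨S₁, S₂, h₁, h₂, rfl⟩⟩

/-! ### Supports for the closure of a tableau that tests a proposition -/

section TestRoot

variable {Sig : Set (Proposition k L)} {φ : Proposition k L}

theorem conclusions_testRoot_subset (E : Set (Element k L)) :
    conclusions E (testRoot Sig φ) ⊆ Element.prop '' E := by
  rintro ψ ⟨S, hS, ⟨σ, -, ⟨⟩⟩ | ⟨⟨⟩⟩⟩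
  · exact ⟨.premise ψ, hS rfl, rfl⟩
  · exact ⟨.test φ.neg, hS rfl, rfl⟩

theorem subset_conclusions_testRoot {E : Set (Element k L)}
    (hE : E ⊆ Element.premise '' Sig ∪ {.test φ.neg}) :
    Element.prop '' E ⊆ conclusions E (testRoot Sig φ) := by
  rintro ψ ⟨e, he, rfl⟩
  refine ⟨{e}, Set.singleton_subset_iff.2 he, ?_⟩
  rcases hE he with ⟨σ, hσ, rfl⟩ | rfl
  · exact Or.inl ⟨σ, hσ, rfl⟩
  · exact Or.inr rfl

theorem Tableau.IsClosureSupport.derives_prop_bot {T : Tableau (testRoot Sig φ)}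
    {S : Set (Element k L)} (h : T.IsClosureSupport S) : Derives (Element.prop '' S) .bot :=
  .weaken (conclusions_testRoot_subset S) h.derives_bot

/-- Refutation: the premises of a support for the closure entail the tested proposition. -/
theorem Tableau.IsClosureSupport.derives_prop {T : Tableau (testRoot Sig φ)}
    {S : Set (Element k L)} (h : T.IsClosureSupport S) :
    Derives (Element.prop '' (S \ {.test φ.neg})) φ := by
  refine .by_contradiction (.weaken ?_ h.derives_prop_bot)
  rintro _ ⟨e, he, rfl⟩
  by_cases het : e = .test φ.neg
  · exact Or.inl (congrArg Element.prop het)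
  · exact Or.inr ⟨e, ⟨he, het⟩, rfl⟩

theorem Tableau.exists_extends_testRoot (T : Tableau (testRoot Sig φ))
    (hfresh : k = .predicate →
      {c : L.Const | ∀ ψ ∈ insert φ Sig, ¬ ψ.Occurs (.const c)}.Infinite)
    {E : Set (Element k L)} (hE : E ⊆ Element.premise '' Sig ∪ {.test φ.neg}) (hfin : E.Finite)
    (hd : Derives (Element.prop '' E) .bot) :
    ∃ T' : Tableau (testRoot Sig φ), T.Extends T' ∧ ∃ S ⊆ E, T'.IsClosureSupport S := by
  refine T.exists_extends_isClosureSupport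
    ⟨(hfin.image _).subset (conclusions_testRoot_subset E), fun hk => (hfresh hk).mono ?_⟩
    (.weaken (subset_conclusions_testRoot hE) hd)
  rintro c hc ⟨_, ⟨σ, hσ, rfl⟩ | rfl, ho⟩
  · exact hc σ (Or.inr hσ) ho
  · exact hc φ (Or.inl rfl) ho

theorem finite_of_minimal_derives {X : Set (Proposition k L)}
    (h : Minimal (fun X => Derives X φ) X) : X.Finite := by
  obtain ⟨Y, hY, hf, hd⟩ := h.prop.exists_finite
  exact hf.subset (h.le_of_le hd hY)

/-- Minimality of the premises turns the inclusion of a support into an equality. -/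
theorem Tableau.IsClosureSupport.premise_subset {T : Tableau (testRoot Sig φ)}
    {S : Set (Element k L)} (h : T.IsClosureSupport S) {X : Set (Proposition k L)}
    (hX : Minimal (fun X => Derives X φ) X)
    (hS : S ⊆ Element.premise '' X ∪ {.test φ.neg}) : Element.premise '' X ⊆ S := by
  have hprem : ∀ e ∈ S \ {.test φ.neg}, ∃ σ ∈ X, .premise σ = e := fun e he =>
    (hS he.1).resolve_right he.2
  have hsub : Element.prop '' (S \ {.test φ.neg}) ⊆ X := by
    rintro _ ⟨e, he, rfl⟩
    obtain ⟨σ, hσ, rfl⟩ := hprem e he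
    exact hσ
  rintro _ ⟨σ, hσ, rfl⟩
  obtain ⟨e, he, rfl⟩ := hX.le_of_le h.derives_prop hsub hσ
  obtain ⟨σ, -, rfl⟩ := hprem e he
  exact he.1

end TestRoot

end ArgTableau

theorem mainTheorem3 {k : ArgTableau.Logic} {L : ArgTableau.Signature.{u, v, w}}
    (Sig : Set (ArgTableau.Proposition k L)) (φ : ArgTableau.Proposition k L)
    (T : ArgTableau.Tableau (ArgTableau.testRoot Sig φ)) :
    (∀ S : Set (ArgTableau.Element k L), T.IsClosureSupport S →
      {e ∈ S | e.IsTest} = {ArgTableau.Element.test φ.neg} →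
      ArgTableau.Derives
        (ArgTableau.Element.prop '' (S \ {ArgTableau.Element.test φ.neg})) φ) ∧
    ((k = .predicate →
        {c : L.Const | ∀ ψ ∈ insert φ Sig, ¬ ψ.Occurs (.const c)}.Infinite) →
      ∀ S' ⊆ Sig, Minimal (fun X => ArgTableau.Derives X φ) S' →
        (¬ ArgTableau.Derives S' .bot →
          ∃ T' : ArgTableau.Tableau (ArgTableau.testRoot Sig φ), T.Extends T' ∧
            T'.IsClosureSupport
              (ArgTableau.Element.premise '' S' ∪ {ArgTableau.Element.test φ.neg})) ∧
        (ArgTableau.Derives S' .bot →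
          ∃ T' : ArgTableau.Tableau (ArgTableau.testRoot Sig φ), T.Extends T' ∧
            T'.IsClosureSupport (ArgTableau.Element.premise '' S'))) := by
  open ArgTableau in
  refine ⟨fun S hS _ => hS.derives_prop, fun hfresh S' hS' hmin => ⟨fun hcon => ?_, fun hinc => ?_⟩⟩
  · obtain ⟨T', he, S, hS, h⟩ := T.exists_extends_testRoot hfresh
      (E := Element.premise '' S' ∪ {Element.test φ.neg})
      (Set.union_subset_union_left _ (Set.image_mono hS'))
      (((finite_of_minimal_derives hmin).image _).union (Set.finite_singleton _))
      (.neg_elim (φ := φ)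
        (.weaken (fun σ hσ => ⟨.premise σ, Or.inl ⟨σ, hσ, rfl⟩, rfl⟩) hmin.prop)
        (.hyp ⟨.test φ.neg, Or.inr rfl, rfl⟩))
    have htest : Element.test φ.neg ∈ S := by
      -- A support without the test would make `S'` inconsistent.
      by_contra hn
      refine hcon (.weaken ?_ h.derives_prop_bot)
      rintro _ ⟨e, heS, rfl⟩
      rcases hS heS with ⟨σ, hσ, rfl⟩ | rfl
      · exact hσ
      · exact (hn heS).elim
    have hSeq : S = Element.premise '' S' ∪ {Element.test φ.neg} :=
      hS.antisymm (Set.union_subset (h.premise_subset hmin hS) (Set.singleton_subset_iff.2 htest))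
    exact ⟨T', he, hSeq ▸ h⟩
  · obtain ⟨T', he, S, hS, h⟩ := T.exists_extends_testRoot hfresh (E := Element.premise '' S')
      ((Set.image_mono hS').trans Set.subset_union_left)
      ((finite_of_minimal_derives hmin).image _)
      (.weaken (fun σ hσ => ⟨.premise σ, ⟨σ, hσ, rfl⟩, rfl⟩) hinc)
    have hSeq : S = Element.premise '' S' :=
      hS.antisymm (h.premise_subset hmin (hS.trans Set.subset_union_left))
    exact ⟨T', he, hSeq ▸ h⟩
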